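/- A (complex) JB$^*$-triple is a complex Banach space $F$ with a continuous triple product $\{\cdot,\cdot,\cdot\}:F^3\to F$, symmetric and linear in the outer variables and conjugate linear in the middle one, such that, with $L(a,b)x:=\{a,b,x\}$, $$L(a,b)\{x,y,z\}=\{L(a,b)x,y,z\}-\{x,L(b,a)y,z\}+\{x,y,L(a,b)z\}$$ for all $a,b,x,y,z$, and such that for each $a\in F$ the operator $L(a,a)$ is hermitian (i.e. $\exp(itL(a,a))$ is isometric for all $t\in\mathbb R$) with non-negative spectrum and $\|\{a,a,a\}\|=\|a\|^3$. A real JB$^*$-triple $E$ is a norm-closed real subtriple of a JB$^*$-triple. Elements $a,b\in E$ are orthogonal if $L(a,b)=0$ on $E$; a set $S\subseteq E$ is orthogonal if $0\notin S$ and any two distinct elements of $S$ are orthogonal; the rank of $E$ is the least cardinal $r$ such that every orthogonal subset of $E$ has cardinality at most $r$. A triple derivation of $E$ is a real-linear map $\delta:E\to E$ with $\delta\{a,b,c\}=\{\delta a,b,c\}+\{a,\delta b,c\}+\{a,b,\delta c\}$ for all $a,b,c$; a real-linear map $T:E\to E$ is a local triple derivation if for every $a\in E$ there is a triple derivation $\delta_a$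 of $E$ with $T(a)=\delta_a(a)$. Put $\delta(a,b):=L(a,b)-L(b,a)$; a triple derivation is inner if it is a finite sum of maps $\delta(a_j,b_j)$ with $a_j,b_j\in E$. For a tripotent $e$ (i.e. $\{e,e,e\}=e$) let $E_k(e)=\{x\in E: L(e,e)x=\tfrac k2x\}$, so that $E=E_0(e)\oplus E_1(e)\oplus E_2(e)$, and let $P_1(e)$ be the projection of $E$ onto $E_1(e)$ with kernel $E_0(e)\oplus E_2(e)$. The symmetrized triple product is $\langle a,b,c\rangle:=\frac13(\{a,b,c\}+\{c,a,b\}+\{b,c,a\})$. **Proposition.** Let $E$ be a real JB$^*$-triple of rank one and let $T:E\to E$ be a real-linear derivation of the symmetrized triple product, i.e. $T\langle a,b,c\rangle=\langle Ta,b,c\rangle+\langle a,Tb,c\rangle+\langle a,b,Tc\rangle$ for all $a,b,c\in E$. Then $T$ is a local triple derivation. Moreover, for every $x\in E\setminus\{0\}$ the element $u:=x/\|x\|$ is a tripotent and the map $$\delta:=\frac{1}{2\|x\|}\,\delta\big(T(x)+3P_1(u)T(x),\,u\big)$$ is an inner triple derivation of $E$ with $\delta(x)=T(x)$. -/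

import Mathlib

open scoped ComplexConjugate

/-- A (complex) JB*-triple: a complex Banach space with a continuous triple product `tp x y z`,
symmetric and linear in the outer variables and conjugate linear in the middle one, which satisfies
the Jordan identity, such that every `L(a,a) = tp a a` is hermitian (that is, `exp (i t L(a,a))` is
isometric for all real `t`) with non-negative spectrum and `‖{a,a,a}‖ = ‖a‖ ^ 3`. -/
class JBStarTriple (F : Type*) [NormedAddCommGroup F] [NormedSpace ℂ F] [CompleteSpace F] where
  /-- the triple product, curried; `tp a b` is the operator `L(a,b)` -/
  tp : F →L[ℂ] F →L⋆[ℂ] F →L[ℂ] F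
  symm : ∀ x y z : F, tp x y z = tp z y x
  jordan : ∀ a b x y z : F,
    tp a b (tp x y z) = tp (tp a b x) y z - tp x (tp b a y) z + tp x y (tp a b z)
  hermitian : ∀ (a : F) (t : ℝ) (x : F),
    ‖NormedSpace.exp ((Complex.I * (t : ℂ)) • tp a a) x‖ = ‖x‖
  spectrum_nonneg : ∀ (a : F), ∀ z ∈ spectrum ℂ (tp a a), ∃ r : ℝ, 0 ≤ r ∧ z = (r : ℂ)
  norm_tp_self : ∀ a : F, ‖tp a a a‖ = ‖a‖ ^ 3

/-- A real JB*-triple: a norm-closed real subtriple of a complex JB*-triple `F`. -/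
structure RealJBStarTriple (F : Type*) [NormedAddCommGroup F] [NormedSpace ℂ F] [CompleteSpace F]
    [JBStarTriple F] extends Submodule ℝ F where
  isClosed_carrier : IsClosed carrier
  tp_mem : ∀ {x y z : F}, x ∈ carrier → y ∈ carrier → z ∈ carrier →
    JBStarTriple.tp x y z ∈ carrier

namespace RealJBStarTriple

variable {F : Type*} [NormedAddCommGroup F] [NormedSpace ℂ F] [CompleteSpace F] [JBStarTriple F]

instance : CoeSort (RealJBStarTriple F) (Type _) := ⟨fun E => E.toSubmodule⟩

variable (E : RealJBStarTriple F)

/-- The operator `L(a,b) : c ↦ {a,b,c}` on `E`. -/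
noncomputable def L (a b : E) : E →ₗ[ℝ] E where
  toFun c := ⟨JBStarTriple.tp (a : F) (b : F) (c : F), E.tp_mem a.2 b.2 c.2⟩
  map_add' c d := Subtype.ext (map_add (JBStarTriple.tp (a : F) (b : F)) (c : F) (d : F))
  map_smul' r c :=
    Subtype.ext (map_smul (JBStarTriple.tp (a : F) (b : F)) (r : ℂ) (c : F))

/-- The triple product `{a,b,c}` of `E`. -/
noncomputable def triple (a b c : E) : E := E.L a b c

theorem coe_L (a b c : E) : ((E.L a b c : E) : F) = JBStarTriple.tp (a : F) (b : F) (c : F) := rfl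

/-- The symmetrized triple product `<a,b,c> = ({a,b,c} + {c,a,b} + {b,c,a}) / 3`. -/
noncomputable def symTriple (a b c : E) : E :=
  (1 / 3 : ℝ) • (E.triple a b c + E.triple c a b + E.triple b c a)

/-- Triple derivations of `E` (real linear, not assumed to be continuous). -/
def IsTripleDerivation (δ : E →ₗ[ℝ] E) : Prop :=
  ∀ a b c : E, δ (E.triple a b c) = E.triple (δ a) b c + E.triple a (δ b) c + E.triple a b (δ c)

/-- Triple derivations of the symmetrized triple product. -/
def IsSymTripleDerivation (T : E →ₗ[ℝ] E) : Prop :=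
  ∀ a b c : E,
    T (E.symTriple a b c) = E.symTriple (T a) b c + E.symTriple a (T b) c + E.symTriple a b (T c)

/-- Local triple derivations. -/
def IsLocalTripleDerivation (T : E →ₗ[ℝ] E) : Prop :=
  ∀ a : E, ∃ δ : E →ₗ[ℝ] E, E.IsTripleDerivation δ ∧ T a = δ a

/-- `δ(a,b) = L(a,b) - L(b,a)`. -/
noncomputable def innerDer (a b : E) : E →ₗ[ℝ] E := E.L a b - E.L b a

/-- Inner triple derivations: triple derivations that are finite sums of operators `δ(a,b)`. -/
def IsInnerTripleDerivation (δ : E →ₗ[ℝ] E) : Prop :=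
  E.IsTripleDerivation δ ∧
    ∃ (n : ℕ) (a b : Fin n → E), δ = ∑ j, E.innerDer (a j) (b j)

/-- Orthogonality `a ⊥ b`: `L(a,b) = 0`. -/
def Orthogonal (a b : E) : Prop := E.L a b = 0

/-- Orthogonal subsets of `E`. -/
def IsOrthogonalSet (S : Set E) : Prop :=
  0 ∉ S ∧ ∀ x ∈ S, ∀ y ∈ S, x ≠ y → E.Orthogonal x y

/-- The rank of `E`: the least cardinal that bounds the cardinality of every orthogonal subset. -/
noncomputable def rank : Cardinal :=
  sInf {r : Cardinal | ∀ S : Set E, E.IsOrthogonalSet S → Cardinal.mk S ≤ r}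

/-- Tripotents. -/
def IsTripotent (e : E) : Prop := E.triple e e e = e

/-- The Peirce space `E_k(e) = {x | L(e,e) x = (k/2) x}`. -/
noncomputable def peirceSpace (e : E) (k : ℕ) : Submodule ℝ E :=
  LinearMap.ker (E.L e e - ((k : ℝ) / 2) • LinearMap.id)

theorem mem_peirceSpace {e x : E} {k : ℕ} :
    x ∈ E.peirceSpace e k ↔ E.L e e x = ((k : ℝ) / 2) • x := by
  simp [peirceSpace, sub_eq_zero]

theorem L_cube {e : E} (he : E.IsTripotent e) (x : E) :
    (2 : ℝ) • E.L e e (E.L e e (E.L e e x)) =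
      (3 : ℝ) • E.L e e (E.L e e x) - E.L e e x := by
  have sy : ∀ a b c : E, E.L a b c = E.L c b a :=
    fun a b c => Subtype.ext (JBStarTriple.symm _ _ _)
  have jo : ∀ a b x y z : E, E.L a b (E.L x y z) =
      E.L (E.L a b x) y z - E.L x (E.L b a y) z + E.L x y (E.L a b z) :=
    fun a b x y z => Subtype.ext (JBStarTriple.jordan _ _ _ _ _)
  have ee : E.L e e e = e := he
  have h1 : ∀ y : E, E.L e e y = (2 : ℝ) • E.L e e (E.L e e y) - E.L e (E.L e y e) e := by
    intro y
    have h := jo y e e e e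
    rw [ee, sy y e e, sy (E.L e e y) e e] at h
    linear_combination (norm := module) h
  have h2 : ∀ y : E, E.L e e (E.L e y e) = (2 : ℝ) • E.L e y e - E.L e (E.L e e y) e := by
    intro y
    have h := jo e e e y e
    rw [ee] at h
    linear_combination (norm := module) h
  have h3 : ∀ y : E, E.L e y e = (2 : ℝ) • E.L e e (E.L e y e) - E.L e (E.L e e y) e := by
    intro y
    have h := jo e y e e e
    rw [ee, sy (E.L e y e) e e, sy y e e] at h
    rw [two_smul, add_sub_right_comm]
    exact h
  have h4 : ∀ y : E, E.L e e (E.L e y e) = E.L e y e := by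
    intro y
    have a := h2 y
    have b := h3 y
    have c : (3 : ℝ) • E.L e e (E.L e y e) = (3 : ℝ) • E.L e y e := by
      linear_combination (norm := module) a - b
    exact smul_right_injective E (by norm_num : (3 : ℝ) ≠ 0) c
  have h5 := h4 (E.L e x e)
  have h6 : E.L e (E.L e x e) e = (2 : ℝ) • E.L e e (E.L e e x) - E.L e e x := by
    linear_combination (norm := module) h1 x
  rw [h6, map_sub, map_smul] at h5
  linear_combination (norm := module) h5

/-- Peirce decomposition `E = E_1(e) ⊕ (E_0(e) ⊕ E_2(e))` at a tripotent. -/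
theorem isCompl_peirceSpace {e : E} (he : E.IsTripotent e) :
    IsCompl (E.peirceSpace e 1) (E.peirceSpace e 0 ⊔ E.peirceSpace e 2) := by
  constructor
  · rw [Submodule.disjoint_def]
    intro x hx hx'
    obtain ⟨a, ha, b, hb, rfl⟩ := Submodule.mem_sup.1 hx'
    rw [mem_peirceSpace] at hx ha hb
    norm_num at hx ha hb
    rw [ha, hb] at hx
    have h : b = a := by
      linear_combination (norm := module) (2 : ℝ) • hx
    subst h
    rw [ha] at hb
    simp [← hb]
  · rw [codisjoint_iff, eq_top_iff]
    intro x _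
    have h := E.L_cube he x
    have hx : x = (4 : ℝ) • (E.L e e x - E.L e e (E.L e e x)) +
        ((x - (3 : ℝ) • E.L e e x + (2 : ℝ) • E.L e e (E.L e e x)) +
          ((2 : ℝ) • E.L e e (E.L e e x) - E.L e e x)) := by module
    rw [hx]
    refine Submodule.add_mem_sup ?_ (Submodule.add_mem_sup ?_ ?_) <;>
      rw [mem_peirceSpace] <;> simp only [map_add, map_sub, map_smul] <;> push_cast
    · linear_combination (norm := module) (-2 : ℝ) • h
    · linear_combination (norm := module) h
    · linear_combination (norm := module) h

/-- The Peirce projection `P_1(e)`: the projection onto `E_1(e)` along `E_0(e) ⊕ E_2(e)`. -/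
noncomputable def peirceProj₁ (e : E) (he : E.IsTripotent e) : E →ₗ[ℝ] E :=
  Submodule.projection _ _ (E.isCompl_peirceSpace he)

end RealJBStarTriple

/-! ### Odd powers of an element and polynomial functional calculus. -/

namespace JBStarTriple

open Polynomial Filter Topology

variable {F : Type*} [NormedAddCommGroup F] [NormedSpace ℂ F] [CompleteSpace F] [JBStarTriple F]

/-! In rank one, every nonzero element is a multiple of a tripotent: `p ↦ p(L(x,x)) x` extends to
continuous functions on `[0, ‖L(x,x)‖]`, and functions with product zero give elements whose cubes
are orthogonal, so one of them vanishes. Connectedness of the interval then makes `L(x,x)` act on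
`x` as a scalar (`triple_self_of_rank_eq_one`).

At a tripotent `e`, applying `T` to `e = ⟨e,e,e⟩` gives `y = 2 L(e,e) y + {e,y,e}` for `y = T e`. By
Peirce arithmetic `y` has no `E_0(e)` part and `{e,·,e}` negates its `E_2(e)` part; this is exactly
what lets an inner derivation take `e` to `y` (`innerDer_apply_tripotent`). Homogeneity passes from
`e` to its multiples. -/

theorem tp_commutator (a b x y : F) :
    tp a b * tp x y - tp x y * tp a b = tp (tp a b x) y - tp x (tp b a y) := by
  ext z
  have h := jordan a b x y z
  change tp a b (tp x y z) - tp x y (tp a b z) = tp (tp a b x) y z - tp x (tp b a y) z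
  rw [h]; abel

/-- Operators `L(aₘ, aₙ)` at the odd powers `aₙ = L(x,x)ⁿ x` depend on `m + n` only. -/
theorem tp_pow_pow (x : F) (N : ℕ) : ∀ m n : ℕ, m + n = N →
    tp ((tp x x ^ m) x) ((tp x x ^ n) x) = tp ((tp x x ^ N) x) x := by
  set h : F →L[ℂ] F := tp x x with hh
  set D : ℕ → ℕ → F →L[ℂ] F := fun m n => tp ((h ^ m) x) ((h ^ n) x) with hD
  have hs (n : ℕ) : h ((h ^ n) x) = (h ^ (n + 1)) x := by rw [pow_succ']; rfl
  have hc (m n : ℕ) : h * D m n - D m n * h = D (m + 1) n - D m (n + 1) := by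
    have := tp_commutator x x ((h ^ m) x) ((h ^ n) x)
    rwa [← hh, hs, hs] at this
  suffices H : ∀ m n : ℕ, m + n = N → D m n = D N 0 by simpa [hD] using H
  induction N with
  | zero => intro m n hmn; obtain ⟨rfl, rfl⟩ : m = 0 ∧ n = 0 := by omega
            rfl
  | succ N ih =>
    set c := h * D N 0 - D N 0 * h with hcdef
    have h1 (m n : ℕ) (hmn : m + n = N) : D (m + 1) n = D m (n + 1) + c := by
      rw [hcdef, ← ih m n hmn, hc]; abel
    have h2 (m : ℕ) : ∀ n, m + n = N + 1 → D m n = D 0 (N + 1) + m • c := by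
      induction m with
      | zero => intro n hn; obtain rfl : n = N + 1 := by omega
                simp
      | succ m ihm =>
        intro n hn
        rw [h1 m n (by omega), ihm (n + 1) (by omega), add_assoc, succ_nsmul]
    -- The Jordan identity with the two operators interchanged gives the difference as `-c`, whereas
    -- the recursion `h2` gives `(N + 1) c`; hence `(N + 2) c = 0`.
    have h3 : D (N + 1) 0 - D 0 (N + 1) = -c := by
      have e := tp_commutator ((h ^ N) x) x x x
      have e1 : tp ((h ^ N) x) x x = (h ^ (N + 1)) x := by rw [symm, ← hh, hs]
      have e2 : tp x ((h ^ N) x) x = (h ^ (N + 1)) x := by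
        have := ih 0 N (by omega)
        simp only [hD, pow_zero, one_apply_eq_self] at this
        rw [this, e1]
      rw [e1, e2, ← hh] at e
      simp only [hcdef, hD, pow_zero, one_apply_eq_self]
      rw [← e]; abel
    have h4 := h2 (N + 1) 0 (by omega)
    have hc0 : c = 0 := by
      rw [h4, add_sub_cancel_left] at h3
      have h5 : ((N : ℂ) + 2) • c = 0 := by
        rw [← Nat.cast_smul_eq_nsmul ℂ] at h3
        push_cast at h3
        linear_combination (norm := module) h3
      exact (smul_eq_zero.1 h5).resolve_left (by norm_cast)
    intro m n hmn
    rw [h2 m n hmn, h4, hc0]; simp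

theorem tp_pow_comm (x : F) (n : ℕ) : Commute (tp x x) (tp ((tp x x ^ n) x) x) := by
  have e := tp_commutator x x ((tp x x ^ n) x) x
  have e1 : tp x x ((tp x x ^ n) x) = (tp x x ^ (n + 1)) x := by rw [pow_succ']; rfl
  have e2 := tp_pow_pow x (n + 1) n 1 rfl
  rw [pow_one] at e2
  rw [e1, e2, sub_self, sub_eq_zero] at e
  exact e

theorem tp_pow_pow_pow (x : F) (m n k : ℕ) :
    tp ((tp x x ^ m) x) ((tp x x ^ n) x) ((tp x x ^ k) x) = (tp x x ^ (m + n + k + 1)) x := by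
  have hmul (A B : F →L[ℂ] F) (y : F) : A (B y) = (A * B) y := rfl
  rw [tp_pow_pow x (m + n) m n rfl, hmul, ← ((tp_pow_comm x (m + n)).pow_left k).eq, ← hmul,
    symm, hmul, hmul, mul_assoc, ← pow_succ', ← pow_add]
  congr 2; ring

/-- The odd functional calculus `p ↦ p(L(x,x)) x` on real polynomials. -/
noncomputable def oddEval (x : F) : ℝ[X] →ₗ[ℝ] F where
  toFun p := aeval (tp x x) p x
  map_add' p q := by simp
  map_smul' r p := by rw [map_smul]; rfl

theorem oddEval_monomial (x : F) (n : ℕ) (r : ℝ) :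
    oddEval x (monomial n r) = r • (tp x x ^ n) x := by
  change aeval (tp x x) (monomial n r) x = _
  rw [aeval_monomial, ← Algebra.smul_def]
  rfl

theorem tp_real_smul (r s t : ℝ) (a b c : F) :
    tp (r • a) (s • b) (t • c) = (r * s * t) • tp a b c := by
  simp only [← Complex.coe_smul, map_smul, map_smulₛₗ, smul_apply,
    Complex.conj_ofReal, smul_smul]
  push_cast
  congr 1; ring

/-- If `p` stands for the odd function `λ p(λ²)`, this is pointwise multiplication of three odd
functions; the factor `X` is the surplus `λ²`. -/
theorem tp_oddEval (x : F) (p q r : ℝ[X]) :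
    tp (oddEval x p) (oddEval x q) (oddEval x r) = oddEval x (X * p * q * r) := by
  induction p using Polynomial.induction_on' with
  | add p p' hp hp' =>
    simp only [map_add, add_apply, hp, hp', mul_add, add_mul]
  | monomial m a =>
  induction q using Polynomial.induction_on' with
  | add p p' hp hp' =>
    simp only [map_add, add_apply, hp, hp', mul_add, add_mul]
  | monomial n b =>
  induction r using Polynomial.induction_on' with
  | add p p' hp hp' =>
    simp only [map_add, hp, hp', mul_add]
  | monomial k c =>
  rw [X_mul_monomial, monomial_mul_monomial, monomial_mul_monomial]
  simp only [oddEval_monomial]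
  rw [tp_real_smul, tp_pow_pow_pow]
  congr 3; ring

/-- Iterating `‖{a,a,a}‖ = ‖a‖ ^ 3`: cubing sends the exponent `k` to `3 * k + 1`. -/
theorem norm_oddEval_pow (x : F) (p : ℝ[X]) (n : ℕ) :
    ∃ k ≥ n, ‖oddEval x p‖ ^ (2 * k + 1) = ‖oddEval x (p * (X * p ^ 2) ^ k)‖ := by
  induction n with
  | zero => exact ⟨0, le_rfl, by simp⟩
  | succ n ih =>
    obtain ⟨k, hk, e⟩ := ih
    refine ⟨3 * k + 1, by omega, ?_⟩
    have := norm_tp_self (oddEval x (p * (X * p ^ 2) ^ k))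
    rw [tp_oddEval, ← e, ← pow_mul] at this
    rw [show 2 * (3 * k + 1) + 1 = (2 * k + 1) * 3 by ring, ← this]
    congr 2; ring

theorem oddEval_mul_apply (x : F) (p q : ℝ[X]) :
    oddEval x (p * q) = aeval (tp x x) p (oddEval x q) := by
  change aeval (tp x x) (p * q) x = _
  rw [map_mul]; rfl

/-- With `g = (X p²)(L(x,x))` and `a = ‖oddEval x p‖`, the power identity gives `a ^ (2k+1) ≤ ‖g ^
k‖ a` for arbitrarily large `k`. By spectral mapping and Gelfand's formula `‖g ^ k‖ ≤ ρ ^ k`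
eventually, which excludes `a² > ρ`. -/
theorem norm_sq_oddEval_le (x : F) (p : ℝ[X]) {ρ : ℝ} (hρ : 0 < ρ)
    (h : ∀ z ∈ spectrum ℂ (tp x x), ‖eval z ((X * p ^ 2).map (algebraMap ℝ ℂ))‖ < ρ) :
    ‖oddEval x p‖ ^ 2 ≤ ρ := by
  rcases subsingleton_or_nontrivial F with hF | hF
  · rw [Subsingleton.elim (oddEval x p) 0]; simp [hρ.le]
  set g : F →L[ℂ] F := aeval (tp x x) (X * p ^ 2) with hg
  have hg' : g = aeval (tp x x) ((X * p ^ 2).map (algebraMap ℝ ℂ)) := by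
    rw [aeval_map_algebraMap]
  have hr : spectralRadius ℂ g < ENNReal.ofReal ρ := by
    rw [ENNReal.ofReal_eq_coe_nnreal hρ.le]
    apply spectrum.spectralRadius_lt_of_forall_lt_of_nonempty (spectrum.nonempty g)
    intro z hz
    rw [hg', spectrum.map_polynomial_aeval] at hz
    obtain ⟨w, hw, rfl⟩ := hz
    exact h w hw
  have hev : ∀ᶠ k : ℕ in atTop, ‖g ^ k‖ ≤ ρ ^ k := by
    filter_upwards [(spectrum.pow_norm_pow_one_div_tendsto_nhds_spectralRadius g).eventually_lt_const
      hr, eventually_gt_atTop 0] with k hk hk0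
    rw [ENNReal.ofReal_lt_ofReal_iff hρ, one_div] at hk
    calc ‖g ^ k‖ = (‖g ^ k‖ ^ (k : ℝ)⁻¹) ^ k := (Real.rpow_inv_natCast_pow (norm_nonneg _) hk0.ne').symm
      _ ≤ ρ ^ k := by gcongr
  by_contra! hlt
  have ha : 0 < ‖oddEval x p‖ := by
    by_contra! h0
    have : ‖oddEval x p‖ = 0 := le_antisymm h0 (norm_nonneg _)
    rw [this] at hlt; norm_num at hlt; linarith
  set a := ‖oddEval x p‖ with haDef
  have h1 : 1 < a ^ 2 / ρ := (one_lt_div hρ).2 hlt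
  obtain ⟨n₀, hn₀⟩ := eventually_atTop.1 (hev.and
    ((tendsto_pow_atTop_atTop_of_one_lt h1).eventually_gt_atTop 1))
  obtain ⟨k, hk, e⟩ := norm_oddEval_pow x p n₀
  obtain ⟨h3, h4⟩ := hn₀ k hk
  rw [mul_comm p, oddEval_mul_apply, map_pow, ← hg, ← haDef] at e
  have h5 : a ^ (2 * k + 1) ≤ ρ ^ k * a := by
    rw [e]
    exact ((g ^ k).le_opNorm _).trans (by gcongr)
  rw [pow_succ, pow_mul] at h5
  have h6 := le_of_mul_le_mul_right h5 ha
  rw [div_pow, one_lt_div (by positivity)] at h4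
  linarith

theorem norm_oddEval_le (x : F) (p : ℝ[X]) {M : ℝ}
    (hM : ∀ t ∈ Set.Icc 0 ‖tp x x‖, |p.eval t| ≤ M) :
    ‖oddEval x p‖ ≤ Real.sqrt ‖tp x x‖ * M := by
  rcases subsingleton_or_nontrivial F with hF | hF
  · rw [Subsingleton.elim (oddEval x p) 0, norm_zero]
    exact mul_nonneg (Real.sqrt_nonneg _)
      ((abs_nonneg _).trans (hM 0 ⟨le_rfl, norm_nonneg _⟩))
  have hM0 : 0 ≤ M := (abs_nonneg _).trans (hM 0 ⟨le_rfl, norm_nonneg _⟩)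
  refine (sq_le_sq₀ (norm_nonneg _) (by positivity)).1 ?_
  rw [mul_pow, Real.sq_sqrt (norm_nonneg _)]
  refine le_of_forall_pos_lt_add fun ε hε => ?_
  -- The slack `ε / 2` makes `ρ` positive and the spectral bound strict.
  refine (norm_sq_oddEval_le x p (ρ := ‖tp x x‖ * M ^ 2 + ε / 2) (by positivity) ?_).trans_lt
    (by linarith)
  intro z hz
  obtain ⟨r, hr, rfl⟩ := spectrum_nonneg x z hz
  have hr' : r ≤ ‖tp x x‖ := by
    simpa [abs_of_nonneg hr] using spectrum.norm_le_norm_of_mem hz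
  rw [← Complex.coe_algebraMap, eval_map_algebraMap, aeval_algebraMap_apply_eq_algebraMap_eval,
    Complex.coe_algebraMap, Complex.norm_real, eval_mul, eval_X, eval_pow, norm_mul, norm_pow,
    Real.norm_eq_abs, Real.norm_eq_abs, abs_of_nonneg hr]
  have : r * |p.eval r| ^ 2 ≤ ‖tp x x‖ * M ^ 2 := by
    gcongr
    exact hM r ⟨hr, hr'⟩
  linarith

end JBStarTriple

/-! ### Continuous functional calculus and orthogonality of cubes. -/

namespace JBStarTriple

open Polynomial Filter Topology

variable {F : Type*} [NormedAddCommGroup F] [NormedSpace ℂ F] [CompleteSpace F] [JBStarTriple F]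

theorem denseRange_toContinuousMapOn (a b : ℝ) :
    DenseRange ((toContinuousMapOnAlgHom (R := ℝ) (Set.Icc a b)).toLinearMap) := by
  intro f
  refine closure_mono ?_ (continuousMap_mem_polynomialFunctions_closure a b f)
  rintro _ ⟨p, -, rfl⟩
  exact ⟨p, rfl⟩

/-- The odd functional calculus `f ↦ f(L(x,x)) x` on continuous real functions. -/
noncomputable def oddCalculus (x : F) : C(Set.Icc 0 ‖tp x x‖, ℝ) →L[ℝ] F :=
  (oddEval x).extendOfNorm (toContinuousMapOnAlgHom (R := ℝ) _).toLinearMap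

theorem norm_oddEval_le_norm (x : F) (p : ℝ[X]) :
    ‖oddEval x p‖ ≤ Real.sqrt ‖tp x x‖ *
      ‖(toContinuousMapOnAlgHom (R := ℝ) (Set.Icc 0 ‖tp x x‖)).toLinearMap p‖ := by
  refine norm_oddEval_le x p fun t ht => ?_
  rw [← Real.norm_eq_abs]
  exact ContinuousMap.norm_coe_le_norm
    ((toContinuousMapOnAlgHom (R := ℝ) (Set.Icc 0 ‖tp x x‖)).toLinearMap p) ⟨t, ht⟩

theorem oddCalculus_toContinuousMapOn (x : F) (p : ℝ[X]) :
    oddCalculus x (p.toContinuousMapOn _) = oddEval x p :=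
  LinearMap.extendOfNorm_eq (denseRange_toContinuousMapOn _ _) ⟨_, norm_oddEval_le_norm x⟩ p

theorem tp_oddCalculus (x : F) (f g k : C(Set.Icc 0 ‖tp x x‖, ℝ)) :
    tp (oddCalculus x f) (oddCalculus x g) (oddCalculus x k) =
      oddCalculus x ((X : ℝ[X]).toContinuousMapOn _ * f * g * k) := by
  have hd := denseRange_toContinuousMapOn 0 ‖tp x x‖
  have c1 (b c : F) : Continuous fun a : F => tp a b c :=
    (continuous_eval_const c).comp ((continuous_eval_const b).comp (tp (F := F)).continuous)
  have c2 (a c : F) : Continuous fun b : F => tp a b c :=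
    (continuous_eval_const c).comp (tp a).continuous
  induction f using hd.induction_on with
  | hp => exact isClosed_eq ((c1 _ _).comp (oddCalculus x).continuous) (by fun_prop)
  | ih p =>
  induction g using hd.induction_on with
  | hp => exact isClosed_eq ((c2 _ _).comp (oddCalculus x).continuous) (by fun_prop)
  | ih q =>
  induction k using hd.induction_on with
  | hp => exact isClosed_eq (by fun_prop) (by fun_prop)
  | ih r =>
    change tp (oddCalculus x (p.toContinuousMapOn _)) (oddCalculus x (q.toContinuousMapOn _))
      (oddCalculus x (r.toContinuousMapOn _)) = _
    rw [oddCalculus_toContinuousMapOn, oddCalculus_toContinuousMapOn,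
      oddCalculus_toContinuousMapOn, tp_oddEval, ← oddCalculus_toContinuousMapOn]
    congr 1
    ext t
    simp

theorem oddEval_mem (E : RealJBStarTriple F) {x : F} (hx : x ∈ E.toSubmodule) (p : ℝ[X]) :
    oddEval x p ∈ E.toSubmodule := by
  have h (n : ℕ) : (tp x x ^ n) x ∈ E.toSubmodule := by
    induction n with
    | zero => simpa
    | succ n ih => rw [pow_succ']; exact E.tp_mem hx hx ih
  induction p using Polynomial.induction_on' with
  | add p q hp hq => rw [map_add]; exact add_mem hp hq
  | monomial n a => rw [oddEval_monomial]; exact E.smul_mem a (h n)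

theorem oddCalculus_mem (E : RealJBStarTriple F) {x : F} (hx : x ∈ E.toSubmodule)
    (f : C(Set.Icc 0 ‖tp x x‖, ℝ)) : oddCalculus x f ∈ E.toSubmodule := by
  refine (denseRange_toContinuousMapOn 0 ‖tp x x‖).induction_on
    (p := fun f => oddCalculus x f ∈ E.toSubmodule) f ?_ fun p => ?_
  · exact E.isClosed_carrier.preimage (oddCalculus x).continuous
  · change oddCalculus x (p.toContinuousMapOn _) ∈ _
    rw [oddCalculus_toContinuousMapOn]
    exact oddEval_mem E hx p

/-- The commutator of `L(c,c)` and `L(c,b)`, expanded in either order, is `L({c,c,c}, b)` up to sign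
one way and zero the other. Passing to the cube loses nothing, since it vanishes only when `c` does.
-/
theorem tp_cube_left_eq_zero {c b : F} (h1 : tp c c b = 0) (h2 : tp c b c = 0) :
    tp (tp c c c) b = 0 := by
  have e1 := tp_commutator c c c b
  have e2 := tp_commutator c b c c
  rw [h1] at e1
  rw [h2, symm b c c, h1] at e2
  simp only [map_zero, zero_apply, sub_zero] at e1 e2
  rw [← e1, ← neg_sub, e2, neg_zero]

theorem tp_cube_right_eq_zero {c b : F} (h1 : tp c c b = 0) (h2 : tp c b c = 0) :
    tp b (tp c c c) = 0 := by
  have e1 := tp_commutator c c b c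
  have e2 := tp_commutator b c c c
  rw [h1] at e1
  rw [h2, symm b c c, h1] at e2
  simp only [map_zero, zero_apply, sub_zero, zero_sub] at e1 e2
  rw [← neg_eq_zero, ← e1, ← neg_sub, e2, neg_zero]

theorem eq_zero_of_tp_self {a : F} (h : tp a a a = 0) : a = 0 := by
  have := norm_tp_self a
  rw [h, norm_zero] at this
  exact norm_eq_zero.1 (pow_eq_zero_iff (by norm_num) |>.1 this.symm)

end JBStarTriple

/-! ### Consequences of rank one. -/

namespace RealJBStarTriple

open JBStarTriple Polynomial

variable {F : Type*} [NormedAddCommGroup F] [NormedSpace ℂ F] [CompleteSpace F] [JBStarTriple F]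
variable (E : RealJBStarTriple F)

/-- The set of bounds contains the cardinality of `E`, so its infimum is attained. -/
theorem mk_le_rank {S : Set E} (hS : E.IsOrthogonalSet S) : Cardinal.mk S ≤ E.rank :=
  csInf_mem (s := {r : Cardinal | ∀ S : Set E, E.IsOrthogonalSet S → Cardinal.mk S ≤ r})
    ⟨Cardinal.mk E, fun S _ => Cardinal.mk_set_le S⟩ S hS

theorem coe_triple (a b c : E) : (E.triple a b c : F) = tp (a : F) (b : F) (c : F) := rfl

theorem triple_self_eq_zero {a : E} : E.triple a a a = 0 ↔ a = 0 := by
  refine ⟨fun h => ?_, fun h => ?_⟩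
  · exact Subtype.ext (eq_zero_of_tp_self (by simpa [coe_triple] using congrArg Subtype.val h))
  · subst h; exact map_zero (E.L 0 0)

variable {E}

theorem eq_zero_or_eq_zero_of_orthogonal (hE : E.rank = 1) {a b : E}
    (hab : E.Orthogonal a b) (hba : E.Orthogonal b a) : a = 0 ∨ b = 0 := by
  by_contra! h
  have hne : a ≠ b := by
    rintro rfl
    exact h.1 (E.triple_self_eq_zero.1 (by unfold triple; rw [show E.L a a = 0 from hab]; rfl))
  have hS : E.IsOrthogonalSet {a, b} := by
    refine ⟨?_, ?_⟩
    · simp [h.1.symm, h.2.symm]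
    · rintro x (rfl | rfl) y (rfl | rfl) hxy
      · exact absurd rfl hxy
      · exact hab
      · exact hba
      · exact absurd rfl hxy
  have := E.mk_le_rank hS
  rw [hE, Cardinal.mk_le_one_iff_set_subsingleton] at this
  exact hne (this (by simp) (by simp))

theorem eq_zero_or_eq_zero_of_oddCalculus (hE : E.rank = 1) (x : E)
    {f g : C(Set.Icc 0 ‖tp (x : F) (x : F)‖, ℝ)} (hfg : f * g = 0) :
    oddCalculus (x : F) f = 0 ∨ oddCalculus (x : F) g = 0 := by
  set c : E := ⟨oddCalculus (x : F) f, oddCalculus_mem E x.2 f⟩ with hc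
  set b : E := ⟨oddCalculus (x : F) g, oddCalculus_mem E x.2 g⟩ with hb
  have h1 : tp (c : F) (c : F) (b : F) = 0 := by
    rw [hc, hb, tp_oddCalculus, mul_assoc, hfg, mul_zero, map_zero]
  have h2 : tp (c : F) (b : F) (c : F) = 0 := by
    rw [hc, hb, tp_oddCalculus, mul_assoc _ f g, hfg, mul_zero, zero_mul, map_zero]
  have h3 : E.Orthogonal (E.triple c c c) b :=
    LinearMap.ext fun z => Subtype.ext <| by
      rw [coe_L, coe_triple, tp_cube_left_eq_zero h1 h2]; rfl
  have h4 : E.Orthogonal b (E.triple c c c) :=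
    LinearMap.ext fun z => Subtype.ext <| by
      rw [coe_L, coe_triple, tp_cube_right_eq_zero h1 h2]; rfl
  refine (eq_zero_or_eq_zero_of_orthogonal hE h3 h4).imp (fun h => ?_) (fun h => ?_)
  · exact congrArg Subtype.val (E.triple_self_eq_zero.1 h)
  · exact congrArg Subtype.val h

/-- In a real JB*-triple of rank one every element is a multiple of a tripotent. -/
theorem triple_self_of_rank_eq_one (hE : E.rank = 1) (x : E) :
    E.triple x x x = ‖x‖ ^ 2 • x := by
  set R := ‖tp (x : F) (x : F)‖ with hR
  have hR0 : 0 ≤ R := norm_nonneg _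
  let f : ℝ → C(Set.Icc 0 R, ℝ) := fun s => ⟨fun t => max (s - t) 0, by fun_prop⟩
  let g : ℝ → C(Set.Icc 0 R, ℝ) := fun s => ⟨fun t => max (t - s) 0, by fun_prop⟩
  have hf : Continuous f := ContinuousMap.continuous_of_continuous_uncurry _ <| by
    change Continuous fun v : ℝ × Set.Icc 0 R => max (v.1 - v.2) 0
    fun_prop
  have hg : Continuous g := ContinuousMap.continuous_of_continuous_uncurry _ <| by
    change Continuous fun v : ℝ × Set.Icc 0 R => max (v.2 - v.1) 0
    fun_prop
  -- Since `f s * g s = 0`, two closed sets of parameters cover `[0, R]`; they contain `0` and `R`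
  -- respectively, so they meet. At a common `s`, `f s - g s = s - t` is annihilated, that is
  -- `{x,x,x} = s x`.
  obtain ⟨s, ⟨hs0, -⟩, hs1, hs2⟩ := isPreconnected_closed_iff.1 (isPreconnected_Icc (a := 0) (b := R))
    {s | oddCalculus (x : F) (f s) = 0} {s | oddCalculus (x : F) (g s) = 0}
    (isClosed_eq ((oddCalculus (x : F)).continuous.comp hf) continuous_const)
    (isClosed_eq ((oddCalculus (x : F)).continuous.comp hg) continuous_const)
    (fun s _ => eq_zero_or_eq_zero_of_oddCalculus hE x <| by
      ext t
      change max (s - t) 0 * max (t - s) 0 = (0 : ℝ)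
      rcases le_total s t with h | h
      · rw [max_eq_right (by linarith), zero_mul]
      · rw [mul_comm, max_eq_right (by linarith), zero_mul])
    ⟨0, ⟨le_rfl, hR0⟩, by
      have : f 0 = 0 := by
        ext t
        exact max_eq_right (by linarith [t.2.1])
      simp [this]⟩
    ⟨R, ⟨hR0, le_rfl⟩, by
      have : g R = 0 := by
        ext t
        exact max_eq_right (by linarith [t.2.2])
      simp [this]⟩
  have key : oddEval (x : F) (monomial 0 s - monomial 1 1) = 0 := by
    rw [← oddCalculus_toContinuousMapOn]
    have : (monomial 0 s - monomial 1 1 : ℝ[X]).toContinuousMapOn (Set.Icc 0 R) = f s - g s := by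
      ext t
      change eval (t : ℝ) (monomial 0 s - monomial 1 1) = max (s - t) 0 - max (t - s) 0
      rw [eval_sub, eval_monomial, eval_monomial]
      rcases le_total s t with h | h
      · rw [max_eq_right (by linarith), max_eq_left (by linarith)]; ring
      · rw [max_eq_left (by linarith), max_eq_right (by linarith)]; ring
    rw [this, map_sub, hs1, hs2, sub_zero]
  rw [map_sub, oddEval_monomial, oddEval_monomial, sub_eq_zero] at key
  have h1 : E.triple x x x = s • x := Subtype.ext <| by
    rw [coe_triple]; simpa using key.symm
  rcases eq_or_ne x 0 with rfl | hx
  · rw [E.triple_self_eq_zero.2 rfl, smul_zero]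
  have h2 : ‖E.triple x x x‖ = ‖x‖ ^ 3 := norm_tp_self (x : F)
  rw [h1, norm_smul, Real.norm_eq_abs, abs_of_nonneg hs0, pow_succ] at h2
  rw [h1, mul_right_cancel₀ (norm_ne_zero_iff.2 hx) h2]

end RealJBStarTriple

/-! ### Inner derivations and Peirce arithmetic at a tripotent. -/

namespace RealJBStarTriple

open JBStarTriple

variable {F : Type*} [NormedAddCommGroup F] [NormedSpace ℂ F] [CompleteSpace F] [JBStarTriple F]
variable {E : RealJBStarTriple F}

theorem L_symm (a b c : E) : E.L a b c = E.L c b a := Subtype.ext (JBStarTriple.symm _ _ _)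

theorem L_jordan (a b x y z : E) : E.L a b (E.L x y z) =
    E.L (E.L a b x) y z - E.L x (E.L b a y) z + E.L x y (E.L a b z) :=
  Subtype.ext (jordan _ _ _ _ _)

theorem L_smul_left (r : ℝ) (a b c : E) : E.L (r • a) b c = r • E.L a b c := by
  rw [L_symm, map_smul, L_symm]

theorem L_add_middle (a b b' c : E) : E.L a (b + b') c = E.L a b c + E.L a b' c := by
  apply Subtype.ext
  simp only [coe_L, Submodule.coe_add, map_add, add_apply]

theorem L_smul_middle (r : ℝ) (a b c : E) : E.L a (r • b) c = r • E.L a b c := by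
  apply Subtype.ext
  simpa [coe_L] using tp_real_smul 1 r 1 (a : F) (b : F) (c : F)

theorem L_sub_left (a a' b c : E) : E.L (a - a') b c = E.L a b c - E.L a' b c := by
  rw [L_symm, map_sub, L_symm c, L_symm c]

theorem L_sub_middle (a b b' c : E) : E.L a (b - b') c = E.L a b c - E.L a b' c := by
  apply Subtype.ext
  simp only [coe_L, Submodule.coe_sub, map_sub, sub_apply]

/-- Antisymmetrizing in `a, b` turns the sign of the middle term in the Jordan identity into a plus.
-/
theorem isTripleDerivation_innerDer (a b : E) : E.IsTripleDerivation (E.innerDer a b) := by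
  intro x y z
  simp only [innerDer, triple, LinearMap.sub_apply, L_sub_left, L_sub_middle, map_sub,
    L_jordan a b x y z, L_jordan b a x y z]
  abel

theorem innerDer_smul_left (r : ℝ) (a b : E) : E.innerDer (r • a) b = r • E.innerDer a b := by
  ext z : 1
  simp only [innerDer, LinearMap.sub_apply, LinearMap.smul_apply, L_smul_left, L_smul_middle,
    smul_sub]

theorem isInnerTripleDerivation_smul_innerDer (r : ℝ) (a b : E) :
    E.IsInnerTripleDerivation (r • E.innerDer a b) := by
  rw [← innerDer_smul_left]
  exact ⟨isTripleDerivation_innerDer _ _, 1, fun _ => r • a, fun _ => b, by simp⟩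

section Peirce

variable {e : E} (he : E.IsTripotent e)
include he

theorem L_conj (y : E) : E.L e e (E.L e y e) = (2 : ℝ) • E.L e y e - E.L e (E.L e e y) e := by
  have h := L_jordan e e e y e
  rw [show E.L e e e = e from he] at h
  rw [two_smul, add_sub_right_comm]
  exact h

/-- Expanding `L(e,e){e,y,e}` and `L(e,y){e,e,e}` by the Jordan identity produces the same term
`{e,{e,e,y},e}`, which cancels. -/
theorem L_conj_eq (y : E) : E.L e e (E.L e y e) = E.L e y e := by
  have h := L_jordan e y e e e
  rw [show E.L e e e = e from he, L_symm (E.L e y e) e e, L_symm y e e] at h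
  have h' := L_conj he y
  have c : (3 : ℝ) • E.L e e (E.L e y e) = (3 : ℝ) • E.L e y e := by
    linear_combination (norm := module) h' - h
  exact smul_right_injective E (by norm_num : (3 : ℝ) ≠ 0) c

theorem conj_L (y : E) : E.L e (E.L e e y) e = E.L e y e := by
  have h := L_conj he y
  rw [L_conj_eq he] at h
  linear_combination (norm := module) h

/-- The quadratic operator `x ↦ {e,x,e}` annihilates `E_k(e)` for `k ≠ 2`. -/
theorem conj_eq_zero {k : ℕ} (hk : k ≠ 2) {y : E} (hy : y ∈ E.peirceSpace e k) :
    E.L e y e = 0 := by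
  have h := conj_L he y
  rw [E.mem_peirceSpace.1 hy, L_smul_middle] at h
  have h' : ((k : ℝ) / 2 - 1) • E.L e y e = 0 := by linear_combination (norm := module) h
  refine (smul_eq_zero.1 h').resolve_left fun h0 => hk ?_
  have : (k : ℝ) = 2 := by linarith
  exact_mod_cast this

/-- If `y = 2 L(e,e) y + {e,y,e}`, then `y` is recovered as the value at `e` of an inner
derivation. -/
theorem innerDer_apply_tripotent {y : E} (hy : y = (2 : ℝ) • E.L e e y + E.L e y e) :
    E.innerDer (y + (3 : ℝ) • E.peirceProj₁ e he y) e e = (2 : ℝ) • y := by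
  obtain ⟨y₁, h₁, w, hw, rfl⟩ :=
    Submodule.mem_sup.1 ((E.isCompl_peirceSpace he).codisjoint.eq_top ▸ Submodule.mem_top (x := y))
  have hproj : E.peirceProj₁ e he (y₁ + w) = y₁ := by
    rw [peirceProj₁, map_add, Submodule.projection_apply_of_mem_left _ h₁,
      Submodule.projection_apply_of_mem_right _ hw, add_zero]
  obtain ⟨y₀, h₀, y₂, h₂, rfl⟩ := Submodule.mem_sup.1 hw
  have q₀ := conj_eq_zero he (by norm_num) h₀
  have q₁ := conj_eq_zero he (by norm_num) h₁
  rw [mem_peirceSpace] at h₀ h₁ h₂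
  norm_num at h₀ h₁ h₂
  simp only [map_add, L_add_middle, h₀, h₁, h₂, q₀, q₁, zero_add] at hy
  have hy' : y₀ = y₂ + E.L e y₂ e := by linear_combination (norm := module) hy
  -- `L(e,e)` kills the left side of `hy'` and fixes the right side, so both are zero.
  have q₂ : E.L e y₂ e = -y₂ := by
    have := congrArg (E.L e e) hy'
    rw [h₀, map_add, h₂, L_conj_eq he] at this
    exact (neg_eq_of_add_eq_zero_right this.symm).symm
  have hy₀ : y₀ = 0 := by rw [hy', q₂, add_neg_cancel]
  subst hy₀
  -- With `y = y₁ + y₂` the value is `4 · ½ y₁ + y₂ - {e,y₂,e} = 2 y₁ + 2 y₂`; the coefficient `3`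
  -- compensates for the eigenvalue `½` and for `{e,y₁,e} = 0`.
  simp only [hproj, innerDer, LinearMap.sub_apply, L_add_middle, L_smul_middle,
    L_symm _ e e, map_add, map_smul, map_zero, h₁, h₂, q₀, q₁, q₂]
  module

end Peirce

theorem symTriple_self (x : E) : E.symTriple x x x = E.triple x x x := by
  unfold symTriple; module

theorem IsSymTripleDerivation.apply_tripotent {T : E →ₗ[ℝ] E} (hT : E.IsSymTripleDerivation T)
    {e : E} (he : E.IsTripotent e) : T e = (2 : ℝ) • E.L e e (T e) + E.L e (T e) e := by
  have h := hT e e e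
  rw [symTriple_self, show E.triple e e e = e from he] at h
  simp only [symTriple, triple, L_symm (T e) e e] at h
  linear_combination (norm := module) h

end RealJBStarTriple

/-! ### The main theorem. -/

theorem mainTheorem5 {F : Type*} [NormedAddCommGroup F] [NormedSpace ℂ F] [CompleteSpace F]
    [JBStarTriple F] (E : RealJBStarTriple F) (hE : E.rank = 1)
    (T : E →ₗ[ℝ] E) (hT : E.IsSymTripleDerivation T) :
    E.IsLocalTripleDerivation T ∧
    ∀ x : E, x ≠ 0 → ∀ u : E, u = ‖x‖⁻¹ • x →
      ∃ hu : E.IsTripotent u, ∀ δ : E →ₗ[ℝ] E,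
        δ = (1 / (2 * ‖x‖)) • E.innerDer (T x + (3 : ℝ) • E.peirceProj₁ u hu (T x)) u →
        E.IsInnerTripleDerivation δ ∧ T x = δ x := by
  have key : ∀ x : E, x ≠ 0 → ∀ u : E, u = ‖x‖⁻¹ • x →
      ∃ hu : E.IsTripotent u, ∀ δ : E →ₗ[ℝ] E,
        δ = (1 / (2 * ‖x‖)) • E.innerDer (T x + (3 : ℝ) • E.peirceProj₁ u hu (T x)) u →
        E.IsInnerTripleDerivation δ ∧ T x = δ x := by
    intro x hx u hxu
    have hx0 : ‖x‖ ≠ 0 := norm_ne_zero_iff.2 hx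
    have hn : ‖u‖ = 1 := by
      rw [hxu, norm_smul, norm_inv, norm_norm, inv_mul_cancel₀ hx0]
    have hu : E.IsTripotent u := by
      change E.triple u u u = u
      rw [RealJBStarTriple.triple_self_of_rank_eq_one hE, hn, one_pow, one_smul]
    refine ⟨hu, ?_⟩
    rintro δ rfl
    refine ⟨RealJBStarTriple.isInnerTripleDerivation_smul_innerDer _ _ _, ?_⟩
    have hxu' : x = ‖x‖ • u := by rw [hxu, smul_smul, mul_inv_cancel₀ hx0, one_smul]
    have hTx : T x = ‖x‖ • T u := by rw [← map_smul, ← hxu']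
    have h := RealJBStarTriple.innerDer_apply_tripotent hu (hT.apply_tripotent hu)
    -- One factor `‖x‖` comes from `T x = ‖x‖ T u`, another from evaluating at `x = ‖x‖ u`; with the
    -- `2` from `h`, the prefactor leaves `‖x‖ T u`.
    have h' : E.innerDer (T x + (3 : ℝ) • E.peirceProj₁ u hu (T x)) u =
        ‖x‖ • E.innerDer (T u + (3 : ℝ) • E.peirceProj₁ u hu (T u)) u := by
      rw [hTx, ← RealJBStarTriple.innerDer_smul_left, map_smul, smul_add, smul_comm (3 : ℝ)]
    rw [h', LinearMap.smul_apply, LinearMap.smul_apply, smul_smul]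
    conv_rhs => rw [hxu', map_smul, h]
    rw [hTx, smul_smul, smul_smul]
    simp only [← hxu']
    congr 1
    field_simp
  refine ⟨fun a => ?_, key⟩
  rcases eq_or_ne a 0 with rfl | ha
  · exact ⟨E.innerDer 0 0, RealJBStarTriple.isTripleDerivation_innerDer 0 0, by simp⟩
  · obtain ⟨hu, h⟩ := key a ha _ rfl
    obtain ⟨h1, h2⟩ := h _ rfl
    exact ⟨_, h1.1, h2⟩
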